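/- Let $G=(V,E)$ be a finite simple planar graph with a given planar combinatorial embedding, let $G$ have maximum degree at most $5$, and let $s\neq t$ be vertices of $G$ with $st\notin E$. The extended dual $G^\star_{st}$ is the dual multigraph $G^\star$ (one vertex for each face of $G$ and, for each edge $e$ of $G$, one edge joining the faces on the two sides of $e$) together with the two additional vertices $s$ and $t$, each joined to every face on whose boundary it lies. An $st$-path in $G^\star_{st}$ is a path from $s$ to $t$ without repeated vertices; its length is its number of edges. Such a path $p$ is called consistent if there is a labeling $l\colon V\to\{L,R\}$ such that, for every edge $uv$ of $G$ crossed by $p$ with $u$ locally to the left and $v$ locally to the right of $p$, we have $l(u)=L$ and $l(v)=R$. Then there is an $st$-path in $G^\star_{st}$ that is of minimum length among all $st$-paths and is consistent. -/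

import Mathlib

universe u

section

variable {V : Type u}

/-- A rotation system of a simple graph: a permutation of the darts (oriented edges) whose
cycles are exactly the sets of darts leaving a common vertex. The dart `next d` is the dart
that follows `d` in counterclockwise order around its tail `d.fst`. -/
structure RotationSystem (G : SimpleGraph V) where
  next : Equiv.Perm G.Dart
  sameCycle_iff : ∀ d d' : G.Dart, next.SameCycle d d' ↔ d.fst = d'.fst

namespace RotationSystem

variable {G : SimpleGraph V} (R : RotationSystem G)

/-- Reversal of darts, as a permutation. -/
def rev (G : SimpleGraph V) : Equiv.Perm G.Dart :=
  (SimpleGraph.Dart.symm_involutive (G := G)).toPerm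

/-- Walking along the dart `d` with a face on the left, the boundary of this face continues
with the dart that precedes `d.symm` in counterclockwise order around the head of `d`. -/
def facePerm : Equiv.Perm G.Dart := R.next⁻¹ * rev G

/-- Facial walks, each of which keeps its face on the left. -/
def FacialWalk : Type u := Quotient (Equiv.Perm.SameCycle.setoid R.facePerm)

/-- The connected pieces of face boundaries: facial walks and isolated vertices. -/
def BoundaryPiece : Type u := R.FacialWalk ⊕ {v : V // ∀ w, ¬ G.Adj v w}

end RotationSystem

/-- A combinatorial embedding of a (possibly disconnected) graph: a rotation system together
with the information which boundary pieces bound a common face. (Every face of a connected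
graph with an edge is bounded by a single facial walk; a face of a disconnected embedded graph
may be bounded by several pieces.) -/
structure CombinatorialEmbedding (G : SimpleGraph V) extends RotationSystem G where
  sameFace : Setoid toRotationSystem.BoundaryPiece

namespace CombinatorialEmbedding

variable {G : SimpleGraph V} (E : CombinatorialEmbedding G)

/-- The faces of the embedding. -/
def Face : Type u := Quotient E.sameFace

/-- The face on the left of a dart. -/
def leftFace (d : G.Dart) : E.Face :=
  Quotient.mk E.sameFace
    (Sum.inl (Quotient.mk (Equiv.Perm.SameCycle.setoid E.toRotationSystem.facePerm) d))

/-- The face on the right of a dart. -/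
def rightFace (d : G.Dart) : E.Face := E.leftFace d.symm

/-- The vertex `v` lies on the boundary of the face `f`. -/
def Incident (v : V) (f : E.Face) : Prop :=
  (∃ d : G.Dart, d.fst = v ∧ E.leftFace d = f) ∨
    ∃ h : ∀ w, ¬ G.Adj v w, Quotient.mk E.sameFace (Sum.inr ⟨v, h⟩) = f

/-- The embedding is planar: the surface that it describes is connected (any two vertices are
linked by passing along edges and through faces), and Euler's formula
`|V| + |F| = |E| + c + 1` holds, where `c` is the number of connected components of `G`. -/
def IsPlanar : Prop :=
  (∀ v w : V, Relation.ReflTransGen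
    (fun x y => G.Adj x y ∨ ∃ f : E.Face, E.Incident x f ∧ E.Incident y f) v w) ∧
  Nat.card V + Nat.card E.Face = Nat.card G.edgeSet + Nat.card G.ConnectedComponent + 1

/-- The vertices of the extended dual: the faces, and the two vertices `s` and `t`. -/
inductive ExtVertex (s t : V) : Type u
  | face (f : E.Face) : ExtVertex s t
  | terminal (x : V) (hx : x = s ∨ x = t) : ExtVertex s t

/-- The edges of the extended dual, each with both of its orientations. The arc `cross d`
crosses the edge of `G` underlying `d`, from the face on the right of `d` to the face on the
left of `d`; hence `d.fst` lies locally to the left and `d.snd` locally to the right of it. -/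
inductive ExtArc (s t : V) : E.ExtVertex s t → E.ExtVertex s t → Type u
  | cross (d : G.Dart) {f g : E.Face} (hf : E.rightFace d = f) (hg : E.leftFace d = g) :
      ExtArc s t (.face f) (.face g)
  | leave (x : V) (hx : x = s ∨ x = t) (f : E.Face) (h : E.Incident x f) :
      ExtArc s t (.terminal x hx) (.face f)
  | enter (x : V) (hx : x = s ∨ x = t) (f : E.Face) (h : E.Incident x f) :
      ExtArc s t (.face f) (.terminal x hx)

instance (s t : V) : Quiver (E.ExtVertex s t) where
  Hom a b := E.ExtArc s t a b

variable {E} {s t : V}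

/-- The dart recorded by an arc that crosses an edge of `G` (none for the other arcs): it points
from the endpoint on the left to the endpoint on the right of the arc. -/
def ExtArc.crossed {a b : E.ExtVertex s t} : E.ExtArc s t a b → Option G.Dart
  | .cross d _ _ => some d
  | .leave _ _ _ _ => none
  | .enter _ _ _ _ => none

/-- The walk `p` crosses the edge underlying `d`, with `d.fst` to the left and `d.snd` to the
right of `p`. -/
def Crosses {a : E.ExtVertex s t} : {b : E.ExtVertex s t} → Quiver.Path a b → G.Dart → Prop
  | _, .nil, _ => False
  | _, .cons p e, d => Crosses p d ∨ ExtArc.crossed e = some d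

variable (E) (s t) in
/-- Walks from `s` to `t` in the extended dual. -/
abbrev STWalk : Type u :=
  Quiver.Path (ExtVertex.terminal s (Or.inl rfl) : E.ExtVertex s t)
    (ExtVertex.terminal t (Or.inr rfl))

/-- An `st`-path is a walk from `s` to `t` that visits no vertex twice. -/
def IsSTPath (p : E.STWalk s t) : Prop := p.vertices.Nodup

/-- A shortest `st`-path: its number of edges is minimum among all `st`-paths. -/
def IsShortestSTPath (p : E.STWalk s t) : Prop :=
  IsSTPath p ∧ ∀ q : E.STWalk s t, IsSTPath q → p.length ≤ q.length

end CombinatorialEmbedding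

/-- The two labels, left and right. -/
inductive Side
  | L
  | R

namespace CombinatorialEmbedding

variable {G : SimpleGraph V} {E : CombinatorialEmbedding G} {s t : V}

/-- The labeling `l` is compatible with every edge of `G` that is crossed by `p`: the endpoint
to the left of `p` is labeled `L` and the endpoint to the right of `p` is labeled `R`. -/
def Compatible (p : E.STWalk s t) (l : V → Side) : Prop :=
  ∀ d : G.Dart, Crosses p d → l d.fst = Side.L ∧ l d.snd = Side.R

/-- The walk `p` is consistent: some labeling of the vertices is compatible with it. -/
def IsConsistent (p : E.STWalk s t) : Prop := ∃ l : V → Side, Compatible p l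

end CombinatorialEmbedding

end

/-!
# Consistent shortest paths in the extended dual

A shortest `st`-path runs through faces `f 0, …, f K`, where `K` is the least number of crossings
that lead from a face at `s` to a face at `t`. The faces stay fixed throughout; what is chosen is
the dart `e i` crossed between `f i` and `f (i + 1)`.

Since all degrees are at most `5`, any two faces at a common vertex are at distance at most `2` in
the dual (`exists_reach_le_two`). Hence a vertex on the edges crossed at steps `i < j` of a shortest
walk forces `j = i + 1`, and a labeling exists as soon as no two *consecutive* crossings conflict,
i.e. have a common endpoint lying on different sides (`Conflict`).

Suppose `e i : a → b` and `e (i + 1) : b → c` conflict at `v`. Around `v` the walk turns first one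
way and then the other, so `b` occurs at `v` next to `a` and again next to `c`. These are four
different corners out of at most five, so on one of the two arcs between the crossed edges there is
nothing else: either `e (i + 1)` or `e i` can be exchanged for another edge at `v` between the same
two faces such that the walk turns around `v` in one direction only (`Conflict.exists_turn`).

Exchanging `e (i + 1)` can only produce a new conflict at step `i + 1`, further on. Exchanging `e i`
can only produce a new conflict at step `i - 1`, at the other endpoint `z` of the new edge. If that
one is resolved by exchanging `e (i - 1)`, the argument continues backwards; if it is resolved by
exchanging `e i` a second time, the newest edge contains `z` and no longer `v`, and there is no
conflict with `e (i + 1)`. So the conflicts can be removed from the start of the walk to its end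
(`IsGeodesic.exists_repair`, `IsGeodesic.exists_conflictFree`).

That some `st`-path exists follows from the connectedness of the embedded surface: the faces at a
common vertex are linked by crossing the edges at this vertex one after the other
(`exists_reach_of_isPlanar`).
-/

namespace RotationSystem

/-! ### Rotations around a vertex of degree at most five -/

variable {V : Type u} {G : SimpleGraph V} (R : RotationSystem G)

lemma fst_next (d : G.Dart) : (R.next d).fst = d.fst :=
  ((R.sameCycle_iff _ _).1 (Equiv.Perm.sameCycle_apply_right.2 (Equiv.Perm.SameCycle.refl _ d))).symm

/-- Two darts with the same tail cut the rotation around it into two arcs, here of `i` and `j`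
steps. -/
lemma exists_pow_next [Fintype V] [DecidableRel G.Adj] (hΔ : G.maxDegree ≤ 5) {d d' : G.Dart}
    (h : d.fst = d'.fst) :
    ∃ i j : ℕ, i + j ≤ 5 ∧ (R.next ^ i) d = d' ∧ (R.next ^ j) d' = d := by
  classical
  let S : Finset G.Dart := {x : G.Dart | x.fst = d.fst}
  have hS : R.next.IsCycleOn S := by
    refine ⟨⟨fun x hx => ?_, R.next.injective.injOn, fun x hx => ⟨R.next⁻¹ x, ?_, ?_⟩⟩,
      fun x hx y hy => ?_⟩
    · simp only [S, Finset.coe_filter, Finset.mem_univ, true_and, Set.mem_ofPred_eq] at hx ⊢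
      rw [R.fst_next, hx]
    · simp only [S, Finset.coe_filter, Finset.mem_univ, true_and, Set.mem_ofPred_eq] at hx ⊢
      rw [← R.fst_next, Equiv.Perm.inv_def, Equiv.apply_symm_apply, hx]
    · exact R.next.apply_symm_apply _
    · simp only [S, Finset.coe_filter, Finset.mem_univ, true_and, Set.mem_ofPred_eq] at hx hy
      exact (R.sameCycle_iff _ _).2 (hx.trans hy.symm)
  have hd : d ∈ S := by simp [S]
  have hd' : d' ∈ S := by simp [S, h]
  have hcard : S.card ≤ 5 := by
    rw [G.dart_fst_fiber_card_eq_degree]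
    exact (G.degree_le_maxDegree _).trans hΔ
  obtain ⟨i, hi, rfl⟩ := hS.exists_pow_eq hd hd'
  refine ⟨i, S.card - i, by omega, rfl, ?_⟩
  rw [← Equiv.Perm.mul_apply, ← pow_add, Nat.sub_add_cancel hi.le, hS.pow_card_apply hd]

/-- Two darts leaving a vertex of degree at most `5` that are distinct and not consecutive: on one
of the two arcs between them there is a single dart. -/
lemma next_next_eq_or [Fintype V] [DecidableRel G.Adj] (hΔ : G.maxDegree ≤ 5) {d d' : G.Dart}
    (h : d.fst = d'.fst) (hne : d ≠ d') (h₁ : R.next d ≠ d') (h₂ : R.next d' ≠ d) :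
    R.next (R.next d) = d' ∨ R.next (R.next d') = d := by
  obtain ⟨i, j, hij, hi, hj⟩ := R.exists_pow_next hΔ h
  have : i ≠ 0 := by rintro rfl; exact hne hi
  have : j ≠ 0 := by rintro rfl; exact hne hj.symm
  have : i ≠ 1 := by rintro rfl; exact h₁ hi
  have : j ≠ 1 := by rintro rfl; exact h₂ hj
  rcases (show i = 2 ∨ j = 2 by omega) with rfl | rfl
  · exact Or.inl hi
  · exact Or.inr hj

end RotationSystem

namespace CombinatorialEmbedding

variable {V : Type u} {G : SimpleGraph V} (E : CombinatorialEmbedding G)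

/-! ### Faces at a vertex and walks in the dual -/

/-- The face `f` occupies a corner at `v`: some dart leaving `v` has `f` on its left. -/
def IsCorner (v : V) (f : E.Face) : Prop := ∃ d : G.Dart, d.fst = v ∧ E.leftFace d = f

lemma leftFace_facePerm (d : G.Dart) :
    E.leftFace (E.toRotationSystem.facePerm d) = E.leftFace d := by
  unfold leftFace
  congr 2
  exact Quotient.sound (Equiv.Perm.sameCycle_apply_left.2 (Equiv.Perm.SameCycle.refl _ d))

lemma facePerm_apply (d : G.Dart) :
    E.toRotationSystem.facePerm d = E.next⁻¹ d.symm := rfl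

@[simp]
lemma rightFace_symm (d : G.Dart) : E.rightFace d.symm = E.leftFace d := by
  simp [rightFace]

@[simp]
lemma leftFace_symm (d : G.Dart) : E.leftFace d.symm = E.rightFace d := rfl

/-- The corner between a dart and its successor lies to the left of the former and to the right
of the latter. -/
lemma rightFace_next (d : G.Dart) : E.rightFace (E.next d) = E.leftFace d := by
  have h := E.leftFace_facePerm (E.next d).symm
  rw [facePerm_apply, SimpleGraph.Dart.symm_symm, Equiv.Perm.inv_def, Equiv.symm_apply_apply] at h
  exact h.symm

lemma isCorner_fst_leftFace (d : G.Dart) : E.IsCorner d.fst (E.leftFace d) := ⟨d, rfl, rfl⟩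

lemma isCorner_snd_leftFace (d : G.Dart) : E.IsCorner d.snd (E.leftFace d) := by
  refine ⟨E.toRotationSystem.facePerm d, ?_, E.leftFace_facePerm d⟩
  rw [facePerm_apply, ← E.toRotationSystem.fst_next, Equiv.Perm.inv_def, Equiv.apply_symm_apply]
  rfl

lemma isCorner_fst_rightFace (d : G.Dart) : E.IsCorner d.fst (E.rightFace d) :=
  E.isCorner_snd_leftFace d.symm

lemma isCorner_snd_rightFace (d : G.Dart) : E.IsCorner d.snd (E.rightFace d) :=
  E.isCorner_fst_leftFace d.symm

/-- `E.Reach n f g`: there is a walk of length `n` from the face `f` to the face `g` in the dual. -/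
def Reach : ℕ → E.Face → E.Face → Prop
  | 0, f, g => f = g
  | n + 1, f, g => ∃ d : G.Dart, Reach n f (E.rightFace d) ∧ E.leftFace d = g

variable {E}

lemma Reach.trans {m n : ℕ} {f g h : E.Face} (h₁ : E.Reach m f g) (h₂ : E.Reach n g h) :
    E.Reach (m + n) f h := by
  induction n generalizing h with
  | zero => exact (show g = h from h₂) ▸ h₁
  | succ n ih =>
    obtain ⟨d, hd, rfl⟩ := h₂
    exact ⟨d, ih hd, rfl⟩

lemma reach_dart (d : G.Dart) : E.Reach 1 (E.rightFace d) (E.leftFace d) := ⟨d, rfl, rfl⟩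

lemma Reach.symm {n : ℕ} {f g : E.Face} (h : E.Reach n f g) : E.Reach n g f := by
  induction n generalizing g with
  | zero => exact Eq.symm h
  | succ n ih =>
    obtain ⟨d, hd, rfl⟩ := h
    have h₁ := reach_dart (E := E) d.symm
    rw [rightFace_symm, leftFace_symm] at h₁
    have h₂ := h₁.trans (ih hd)
    rwa [Nat.add_comm] at h₂

lemma Reach.exists_seq {n : ℕ} {f g : E.Face} (h : E.Reach n f g) :
    ∃ φ : ℕ → E.Face, φ 0 = f ∧ φ n = g ∧
      ∀ i < n, ∃ d : G.Dart, E.rightFace d = φ i ∧ E.leftFace d = φ (i + 1) := by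
  induction n generalizing g with
  | zero => exact ⟨fun _ => f, rfl, h, by simp⟩
  | succ n ih =>
    obtain ⟨d, hd, rfl⟩ := h
    obtain ⟨φ, h0, hn, hφ⟩ := ih hd
    refine ⟨Function.update φ (n + 1) (E.leftFace d), by simp [h0], by simp, fun i hi => ?_⟩
    rcases Nat.lt_succ_iff_lt_or_eq.1 hi with hi | rfl
    · obtain ⟨d', h₁, h₂⟩ := hφ i hi
      refine ⟨d', ?_, ?_⟩
      · rw [Function.update_of_ne (by omega), h₁]
      · rw [Function.update_of_ne (by omega), h₂]
    · refine ⟨d, ?_, by simp⟩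
      rw [Function.update_of_ne (by omega), hn]

lemma reach_pow_next (d : G.Dart) (n : ℕ) :
    E.Reach n (E.leftFace d) (E.leftFace ((E.next ^ n) d)) := by
  induction n with
  | zero => exact rfl
  | succ n ih =>
    refine ⟨(E.next ^ (n + 1)) d, ?_, rfl⟩
    rw [pow_succ', Equiv.Perm.mul_apply, rightFace_next]
    exact ih

/-- Going around a vertex of degree at most `5` the shorter way takes at most two steps. -/
lemma exists_reach_le_two [Fintype V] [DecidableRel G.Adj] (hΔ : G.maxDegree ≤ 5)
    {v : V} {f g : E.Face} (hf : E.IsCorner v f) (hg : E.IsCorner v g) : ∃ n ≤ 2, E.Reach n f g := by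
  obtain ⟨d, hd, rfl⟩ := hf
  obtain ⟨d', hd', rfl⟩ := hg
  obtain ⟨i, j, hij, rfl, h⟩ := E.toRotationSystem.exists_pow_next hΔ (hd.trans hd'.symm)
  rcases le_or_gt i 2 with hi | hi
  · exact ⟨i, hi, reach_pow_next d i⟩
  · refine ⟨j, by omega, ?_⟩
    have := reach_pow_next (E := E) ((E.next ^ i) d) j
    rw [h] at this
    exact this.symm

/-! ### Conflicts between consecutive crossings -/

/-- Two crossings conflict if an endpoint that they share lies to the left of one of them and to
the right of the other. -/
def Conflict (e e' : G.Dart) : Prop := e.fst = e'.snd ∨ e.snd = e'.fst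

lemma not_conflict_of_fst_eq {e e' : G.Dart} (h : e.fst = e'.fst) : ¬ Conflict e e' := by
  rintro (h' | h')
  · exact e'.fst_ne_snd (h.symm.trans h')
  · exact e.fst_ne_snd (h.trans h'.symm)

lemma not_conflict_of_snd_eq {e e' : G.Dart} (h : e.snd = e'.snd) : ¬ Conflict e e' := by
  rintro (h' | h')
  · exact e.fst_ne_snd (h'.trans h.symm)
  · exact e'.fst_ne_snd (h'.symm.trans h)

/-- A conflict between `e : a → b` and `e' : b → c` can be resolved at the shared endpoint by
exchanging one of the two crossings for another one between the same faces. -/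
lemma Conflict.exists_turn [Fintype V] [DecidableRel G.Adj] (hΔ : G.maxDegree ≤ 5)
    {e e' : G.Dart} (h : Conflict e e') (hb : E.leftFace e = E.rightFace e')
    (hab : E.rightFace e ≠ E.leftFace e) (hbc : E.rightFace e' ≠ E.leftFace e')
    (hac : E.rightFace e ≠ E.leftFace e') :
    (∃ x : G.Dart, E.rightFace x = E.rightFace e' ∧ E.leftFace x = E.leftFace e' ∧
      (e.fst = e'.snd ∧ x.fst = e.fst ∨ e.snd = e'.fst ∧ x.snd = e.snd)) ∨
    ∃ x : G.Dart, E.rightFace x = E.rightFace e ∧ E.leftFace x = E.leftFace e ∧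
      (x.fst = e'.fst ∨ x.snd = e'.snd) := by
  rcases h with h | h
  · -- The shared endpoint is on the left of `e`: both `e` and `e'.symm` leave it with the middle
    -- face on their left.
    have h₁ : E.next e ≠ e'.symm := fun h' => hbc <| by
      rw [← hb, ← rightFace_next, h', rightFace_symm]
    have h₂ : E.next e'.symm ≠ e := fun h' => hab <| by
      rw [hb, ← E.leftFace_symm e', ← rightFace_next, h']
    have h₀ : e ≠ e'.symm := fun h' => hac <| by rw [h', rightFace_symm]
    rcases E.toRotationSystem.next_next_eq_or hΔ h h₀ h₁ h₂ with h' | h'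
    · refine Or.inl ⟨E.next e, by rw [rightFace_next, hb], ?_, Or.inl ⟨h, ?_⟩⟩
      · rw [← rightFace_next, h', rightFace_symm]
      · exact E.toRotationSystem.fst_next e
    · refine Or.inr ⟨(E.next e'.symm).symm, ?_, ?_, Or.inr ?_⟩
      · rw [rightFace_symm, ← rightFace_next, h']
      · rw [leftFace_symm, rightFace_next, leftFace_symm, hb]
      · exact E.toRotationSystem.fst_next e'.symm
  · -- The shared endpoint is on the right of `e`: both `e.symm` and `e'` leave it with the middle
    -- face on their right.
    have h₁ : E.next e.symm ≠ e' := fun h' => hab <| by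
      rw [hb, ← h', rightFace_next, leftFace_symm]
    have h₂ : E.next e' ≠ e.symm := fun h' => hbc <| by
      rw [← hb, ← rightFace_symm, ← h', rightFace_next]
    have h₀ : e.symm ≠ e' := fun h' => hac <| by rw [← h', leftFace_symm]
    rcases E.toRotationSystem.next_next_eq_or hΔ (show e.symm.fst = e'.fst from h) h₀ h₁ h₂
      with h' | h'
    · refine Or.inr ⟨E.next e.symm, ?_, ?_, Or.inl ?_⟩
      · rw [rightFace_next, leftFace_symm]
      · rw [← rightFace_next, h', hb]
      · exact (E.toRotationSystem.fst_next e.symm).trans h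
    · refine Or.inl ⟨(E.next e').symm, ?_, ?_, Or.inr ⟨h, ?_⟩⟩
      · rw [rightFace_symm, ← rightFace_next, h', rightFace_symm, hb]
      · rw [leftFace_symm, rightFace_next]
      · exact (E.toRotationSystem.fst_next e').trans h.symm

/-! ### Removing all conflicts along a shortest walk -/

/-- `f 0, …, f K` is a shortest walk in the dual. -/
structure IsGeodesic (K : ℕ) (f : ℕ → E.Face) : Prop where
  exists_dart : ∀ i < K, ∃ d : G.Dart, E.rightFace d = f i ∧ E.leftFace d = f (i + 1)
  le_add : ∀ i j n, j ≤ K → E.Reach n (f i) (f j) → j ≤ i + n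

/-- For each `i < K`, crossing `e i` leads from the face `f i` to the face `f (i + 1)`. -/
def IsCrossing (K : ℕ) (f : ℕ → E.Face) (e : ℕ → G.Dart) : Prop :=
  ∀ i < K, E.rightFace (e i) = f i ∧ E.leftFace (e i) = f (i + 1)

lemma IsCrossing.update {K : ℕ} {f : ℕ → E.Face} {e : ℕ → G.Dart} (he : IsCrossing K f e) {j : ℕ}
    {x : G.Dart} (hr : E.rightFace x = f j) (hl : E.leftFace x = f (j + 1)) :
    IsCrossing K f (Function.update e j x) := by
  intro i hi
  rcases eq_or_ne i j with rfl | hij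
  · simpa using ⟨hr, hl⟩
  · simpa [Function.update_of_ne hij] using he i hi

namespace IsGeodesic

variable {K : ℕ} {f : ℕ → E.Face}

lemma ne (hf : IsGeodesic K f) {i j : ℕ} (hij : i < j) (hj : j ≤ K) : f i ≠ f j := fun h => by
  have := hf.le_add i j 0 hj h
  omega

/-- The first and the last face at a vertex are at distance at most `2`, so only consecutive
crossings can share an endpoint. -/
lemma le_succ_of_common_end [Fintype V] [DecidableRel G.Adj] (hΔ : G.maxDegree ≤ 5)
    (hf : IsGeodesic K f) {e : ℕ → G.Dart} (he : IsCrossing K f e) {i j : ℕ} (hi : i < K)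
    (hj : j < K) {z : V} (hz : z = (e i).fst ∨ z = (e i).snd)
    (hz' : z = (e j).fst ∨ z = (e j).snd) : j ≤ i + 1 := by
  have h₁ : E.IsCorner z (f i) := by
    rw [← (he i hi).1]
    rcases hz with rfl | rfl
    exacts [E.isCorner_fst_rightFace _, E.isCorner_snd_rightFace _]
  have h₂ : E.IsCorner z (f (j + 1)) := by
    rw [← (he j hj).2]
    rcases hz' with rfl | rfl
    exacts [E.isCorner_fst_leftFace _, E.isCorner_snd_leftFace _]
  obtain ⟨n, hn, h⟩ := exists_reach_le_two hΔ h₁ h₂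
  have := hf.le_add i (j + 1) n hj h
  omega

/-- Resolving a conflict between steps `i` and `i + 1` of a shortest walk: either step `i + 1` is
exchanged, or step `i` is. -/
lemma exists_turn [Fintype V] [DecidableRel G.Adj] (hΔ : G.maxDegree ≤ 5)
    (hf : IsGeodesic K f) {e : ℕ → G.Dart} (he : IsCrossing K f e) {i : ℕ} (hi : i + 1 < K)
    (h : Conflict (e i) (e (i + 1))) :
    (∃ x : G.Dart, E.rightFace x = f (i + 1) ∧ E.leftFace x = f (i + 1 + 1) ∧
      ((e i).fst = (e (i + 1)).snd ∧ x.fst = (e i).fst ∨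
        (e i).snd = (e (i + 1)).fst ∧ x.snd = (e i).snd)) ∨
    ∃ x : G.Dart, E.rightFace x = f i ∧ E.leftFace x = f (i + 1) ∧
      (x.fst = (e (i + 1)).fst ∨ x.snd = (e (i + 1)).snd) := by
  obtain ⟨r₁, l₁⟩ := he i (by omega)
  obtain ⟨r₂, l₂⟩ := he (i + 1) hi
  have := h.exists_turn (E := E) hΔ (by rw [l₁, r₂])
    (by rw [l₁, r₁]; exact hf.ne (by omega) (by omega))
    (by rw [l₂, r₂]; exact hf.ne (by omega) (by omega))
    (by rw [l₂, r₁]; exact hf.ne (by omega) (by omega))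
  rwa [r₁, l₁, r₂, l₂] at this

/-- If steps `0, …, j` are free of conflicts among each other and step `j` can be exchanged for a
crossing `x` that agrees with step `j + 1` on the side of a common endpoint, then steps `0, …, j`
can be chosen anew so that steps `0, …, j + 1` are free of conflicts. -/
lemma exists_repair [Fintype V] [DecidableRel G.Adj] (hΔ : G.maxDegree ≤ 5)
    (hf : IsGeodesic K f) (j : ℕ) : ∀ e : ℕ → G.Dart, IsCrossing K f e → j + 1 < K →
    (∀ i < j, ¬ Conflict (e i) (e (i + 1))) →
    ∀ x : G.Dart, E.rightFace x = f j → E.leftFace x = f (j + 1) →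
    (x.fst = (e (j + 1)).fst ∨ x.snd = (e (j + 1)).snd) →
    ∃ e' : ℕ → G.Dart, IsCrossing K f e' ∧ (∀ i, j < i → e' i = e i) ∧
      ∀ i ≤ j, ¬ Conflict (e' i) (e' (i + 1)) := by
  induction j with
  | zero =>
    intro e he _ _ x hr hl hx
    refine ⟨Function.update e 0 x, he.update hr hl,
      fun i hi => Function.update_of_ne (by omega) _ _, fun i hi => ?_⟩
    obtain rfl : i = 0 := by omega
    simpa using hx.elim not_conflict_of_fst_eq not_conflict_of_snd_eq
  | succ m ih =>
    intro e he hK hgood x hr hl hx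
    set u := Function.update e (m + 1) x with hu
    have hu' : IsCrossing K f u := he.update hr hl
    have um : u m = e m := Function.update_of_ne (by omega) _ _
    have um1 : u (m + 1) = x := Function.update_self _ _ _
    have um2 : u (m + 1 + 1) = e (m + 1 + 1) := Function.update_of_ne (by omega) _ _
    have hugood : ∀ i < m, ¬ Conflict (u i) (u (i + 1)) := fun i hi => by
      rw [hu, Function.update_of_ne (by omega), Function.update_of_ne (by omega)]
      exact hgood i (by omega)
    have hux : ¬ Conflict (u (m + 1)) (u (m + 1 + 1)) := by
      rw [um1, um2]
      exact hx.elim not_conflict_of_fst_eq not_conflict_of_snd_eq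
    by_cases hc : Conflict (u m) (u (m + 1))
    · rcases hf.exists_turn hΔ hu' (by omega) hc with ⟨y, yr, yl, hy⟩ | ⟨y, yr, yl, hy⟩
      · -- The new conflict is resolved by exchanging step `m + 1` once more, for an edge at the
        -- vertex shared by steps `m` and `m + 1`.
        have far : ∀ z : V, z = (e m).fst ∨ z = (e m).snd →
            z ≠ (e (m + 1 + 1)).fst ∧ z ≠ (e (m + 1 + 1)).snd := fun z hz => by
          constructor <;> intro h
          · have := hf.le_succ_of_common_end hΔ he (by omega) hK hz (Or.inl h)
            omega
          · have := hf.le_succ_of_common_end hΔ he (by omega) hK hz (Or.inr h)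
            omega
        -- Exchanging `x` for its own reversal would identify two faces of the walk.
        have hyx : y ≠ x.symm := by
          rintro rfl
          rw [rightFace_symm, hl] at yr
          exact hf.ne (by omega) (by omega) yr.symm
        rw [um, um1] at hy
        refine ⟨Function.update e (m + 1) y, he.update yr yl,
          fun i hi => Function.update_of_ne (by omega) _ _, fun i hi => ?_⟩
        rcases lt_trichotomy i m with him | rfl | him
        · rw [Function.update_of_ne (by omega), Function.update_of_ne (by omega)]
          exact hgood i (by omega)
        · rw [Function.update_of_ne (by omega), Function.update_self]
          rcases hy with ⟨_, hy⟩ | ⟨_, hy⟩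
          · exact not_conflict_of_fst_eq hy.symm
          · exact not_conflict_of_snd_eq hy.symm
        · obtain rfl : i = m + 1 := by omega
          rw [Function.update_self, Function.update_of_ne (by omega)]
          rcases hy with ⟨hy₁, hy⟩ | ⟨hy₁, hy⟩
          · have hx' : x.fst = (e (m + 1 + 1)).fst :=
              hx.resolve_right fun h => (far _ (Or.inl hy₁.symm)).2 h
            rintro (h | h)
            · exact (far _ (Or.inl hy)).2 h
            · exact hyx (SimpleGraph.Dart.ext _ _ (Prod.ext (hy.trans hy₁) (h.trans hx'.symm)))
          · have hx' : x.snd = (e (m + 1 + 1)).snd :=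
              hx.resolve_left fun h => (far _ (Or.inr hy₁.symm)).1 h
            rintro (h | h)
            · exact hyx (SimpleGraph.Dart.ext _ _ (Prod.ext (h.trans hx'.symm) (hy.trans hy₁)))
            · exact (far _ (Or.inr hy)).1 h
      · obtain ⟨e', he', hfix, hgood'⟩ := ih u hu' (by omega) hugood y yr yl hy
        refine ⟨e', he', fun i hi => ?_, fun i hi => ?_⟩
        · rw [hfix i (by omega), hu, Function.update_of_ne (by omega)]
        · rcases Nat.le_succ_iff.1 hi with hi | rfl
          · exact hgood' i hi
          · rwa [hfix _ (by omega), hfix _ (by omega)]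
    · refine ⟨u, hu', fun i hi => Function.update_of_ne (by omega) _ _, fun i hi => ?_⟩
      rcases lt_trichotomy i m with him | rfl | him
      · exact hugood i him
      · exact hc
      · obtain rfl : i = m + 1 := by omega
        exact hux

/-- The steps `0, …, J` of a shortest walk can be chosen free of conflicts. In the induction, a
conflict at step `J` is either passed on to the next step or removed by `exists_repair`. -/
lemma exists_conflictFree [Fintype V] [DecidableRel G.Adj] (hΔ : G.maxDegree ≤ 5)
    (hf : IsGeodesic K f) {e₀ : ℕ → G.Dart} (he₀ : IsCrossing K f e₀) (J : ℕ) (hJ : J + 1 ≤ K) :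
    ∃ e : ℕ → G.Dart, IsCrossing K f e ∧ ∀ i < J, ¬ Conflict (e i) (e (i + 1)) := by
  induction J with
  | zero => exact ⟨e₀, he₀, by simp⟩
  | succ J ih =>
    obtain ⟨e, he, hgood⟩ := ih (by omega)
    by_cases hc : Conflict (e J) (e (J + 1))
    · rcases hf.exists_turn hΔ he (by omega) hc with ⟨x, hr, hl, hx⟩ | ⟨x, hr, hl, hx⟩
      · refine ⟨Function.update e (J + 1) x, he.update hr hl, fun i hi => ?_⟩
        rcases Nat.lt_succ_iff_lt_or_eq.1 hi with hi | rfl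
        · rw [Function.update_of_ne (by omega), Function.update_of_ne (by omega)]
          exact hgood i hi
        · rw [Function.update_of_ne (by omega), Function.update_self]
          rcases hx with ⟨_, hx⟩ | ⟨_, hx⟩
          · exact not_conflict_of_fst_eq hx.symm
          · exact not_conflict_of_snd_eq hx.symm
      · obtain ⟨e', he', -, hgood'⟩ := hf.exists_repair hΔ J e he (by omega) hgood x hr hl hx
        exact ⟨e', he', fun i hi => hgood' i (by omega)⟩
    · refine ⟨e, he, fun i hi => ?_⟩
      rcases Nat.lt_succ_iff_lt_or_eq.1 hi with hi | rfl
      exacts [hgood i hi, hc]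

/-- A shortest walk can be realized by crossing darts from a set `D` such that no vertex lies to
the left of one dart in `D` and to the right of another. -/
lemma exists_fst_ne_snd [Fintype V] [DecidableRel G.Adj] (hΔ : G.maxDegree ≤ 5)
    (hf : IsGeodesic K f) :
    ∃ D : Set G.Dart,
      (∀ i < K, ∃ d ∈ D, E.rightFace d = f i ∧ E.leftFace d = f (i + 1)) ∧
      ∀ d ∈ D, ∀ d' ∈ D, d.fst ≠ d'.snd := by
  rcases Nat.eq_zero_or_pos K with rfl | hK
  · exact ⟨∅, by simp, by simp⟩
  obtain ⟨d₀, -⟩ := hf.exists_dart 0 hK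
  have : ∀ i, ∃ d : G.Dart, i < K → E.rightFace d = f i ∧ E.leftFace d = f (i + 1) :=
    fun i => if h : i < K then (hf.exists_dart i h).imp fun _ h _ => h
      else ⟨d₀, fun h' => absurd h' h⟩
  choose e₀ he₀ using this
  obtain ⟨e, he, hgood⟩ := hf.exists_conflictFree hΔ he₀ (K - 1) (by omega)
  refine ⟨{d | ∃ i < K, e i = d}, fun i hi => ⟨e i, ⟨i, hi, rfl⟩, he i hi⟩, ?_⟩
  rintro _ ⟨i, hi, rfl⟩ _ ⟨j, hj, rfl⟩ h
  have h₁ := hf.le_succ_of_common_end hΔ he hi hj (Or.inl rfl) (Or.inr h)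
  have h₂ := hf.le_succ_of_common_end hΔ he hj hi (Or.inr rfl) (Or.inl h.symm)
  rcases lt_trichotomy i j with hij | rfl | hij
  · obtain rfl : j = i + 1 := by omega
    exact hgood i (by omega) (Or.inl h)
  · exact (e i).fst_ne_snd h
  · obtain rfl : i = j + 1 := by omega
    exact hgood j (by omega) (Or.inr h.symm)

end IsGeodesic

/-! ### Walks in the extended dual -/

variable {s t : V}

/-- If every walk in the dual from a face at `s` to a face at `t` has length at least `K`, then
every `st`-walk has at least two more edges. The statement is about all walks from `s`, so that it
can be proved edge by edge. -/
lemma length_lower_bound {K : ℕ}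
    (hK : ∀ n f g, E.Incident s f → E.Incident t g → E.Reach n f g → K ≤ n)
    {b : E.ExtVertex s t} (p : Quiver.Path (ExtVertex.terminal s (Or.inl rfl)) b) :
    match b with
    | .face g => (∃ n f, E.Incident s f ∧ E.Reach n f g ∧ n + 1 ≤ p.length) ∨ K + 2 ≤ p.length
    | .terminal x _ => x = s ∨ K + 2 ≤ p.length := by
  induction p with
  | nil => exact Or.inl rfl
  | @cons b c p a ih =>
    change E.ExtArc s t b c at a
    cases a with
    | cross d hf hg =>
      subst hf hg
      simp only [Quiver.Path.length_cons] at ih ⊢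
      rcases ih with ⟨n, f, hf, hn, hl⟩ | ih
      · exact Or.inl ⟨n + 1, f, hf, hn.trans (reach_dart d), by omega⟩
      · exact Or.inr (by omega)
    | leave x hx f h =>
      simp only [Quiver.Path.length_cons] at ih ⊢
      rcases ih with rfl | ih
      · exact Or.inl ⟨0, f, h, rfl, by omega⟩
      · exact Or.inr (by omega)
    | enter x hx f h =>
      simp only [Quiver.Path.length_cons] at ih ⊢
      rcases hx with rfl | rfl
      · exact Or.inl rfl
      · rcases ih with ⟨n, g, hg, hn, hl⟩ | ih
        · have := hK n g f hg h hn
          exact Or.inr (by omega)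
        · exact Or.inr (by omega)

/-- A geodesic in the dual that starts at a face at `s` and crosses darts in `D`, as a path in the
extended dual. -/
lemma exists_path_face {K : ℕ} {f : ℕ → E.Face} (hf : IsGeodesic K f) {D : Set G.Dart}
    (hD : ∀ i < K, ∃ d ∈ D, E.rightFace d = f i ∧ E.leftFace d = f (i + 1))
    (hs : E.Incident s (f 0)) (n : ℕ) (hn : n ≤ K) :
    ∃ p : Quiver.Path (ExtVertex.terminal s (Or.inl rfl) : E.ExtVertex s t)
      (ExtVertex.face (f n)), p.length = n + 1 ∧ (∀ d, Crosses p d → d ∈ D) ∧ p.vertices.Nodup ∧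
      ∀ x ∈ p.vertices, x = .terminal s (Or.inl rfl) ∨ ∃ i ≤ n, x = .face (f i) := by
  induction n with
  | zero =>
    refine ⟨Quiver.Path.nil.cons (ExtArc.leave s (Or.inl rfl) (f 0) hs), rfl, ?_, ?_, ?_⟩
    · rintro d (h | h) <;> cases h
    · simp [Quiver.Path.vertices_cons]
    · simp [Quiver.Path.vertices_cons]
  | succ n ih =>
    obtain ⟨p, hl, hc, hnd, hv⟩ := ih (by omega)
    obtain ⟨e, heD, hr, hl'⟩ := hD n (by omega)
    refine ⟨p.cons (ExtArc.cross e hr hl'), by simp [hl], ?_, ?_, ?_⟩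
    · rintro d (h | h)
      · exact hc d h
      · exact Option.some.inj h ▸ heD
    · rw [Quiver.Path.vertices_cons, List.concat_eq_append, List.nodup_append_comm,
        List.singleton_append, List.nodup_cons]
      refine ⟨fun h => ?_, hnd⟩
      rcases hv _ h with h | ⟨i, hi, h⟩
      · cases h
      · exact hf.ne (by omega) hn (ExtVertex.face.inj h).symm
    · intro x hx
      rw [Quiver.Path.mem_vertices_cons] at hx
      rcases hx with hx | rfl
      · rcases hv x hx with h | ⟨i, hi, h⟩
        · exact Or.inl h
        · exact Or.inr ⟨i, by omega, h⟩
      · exact Or.inr ⟨n + 1, le_rfl, rfl⟩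

/-- A conflict-free choice of crossings along a geodesic from a face at `s` to a face at `t` gives
a consistent path: the tails of the darts in `D` get the label `L`. -/
lemma exists_consistent_path {K : ℕ} {f : ℕ → E.Face} (hf : IsGeodesic K f) {D : Set G.Dart}
    (hD : ∀ i < K, ∃ d ∈ D, E.rightFace d = f i ∧ E.leftFace d = f (i + 1))
    (hne : ∀ d ∈ D, ∀ d' ∈ D, d.fst ≠ d'.snd) (hs : E.Incident s (f 0))
    (ht : E.Incident t (f K)) (hst : s ≠ t) :
    ∃ p : E.STWalk s t, p.length = K + 2 ∧ IsSTPath p ∧ IsConsistent p := by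
  classical
  obtain ⟨p, hl, hc, hnd, hv⟩ := exists_path_face (t := t) hf hD hs K le_rfl
  refine ⟨p.cons (ExtArc.enter t (Or.inr rfl) (f K) ht), by simp [hl], ?_,
    fun v => if ∃ d ∈ D, d.fst = v then Side.L else Side.R, ?_⟩
  · rw [IsSTPath, Quiver.Path.vertices_cons, List.concat_eq_append, List.nodup_append_comm,
      List.singleton_append, List.nodup_cons]
    refine ⟨fun h => ?_, hnd⟩
    rcases hv _ h with h | ⟨i, hi, h⟩
    · exact hst (ExtVertex.terminal.inj h).symm
    · cases h
  · rintro d (h | h)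
    · have hd := hc d h
      refine ⟨if_pos ⟨d, hd, rfl⟩, if_neg ?_⟩
      rintro ⟨d', hd', h⟩
      exact hne d' hd' d hd h
    · cases h

/-! ### Connectedness of the dual -/

lemma exists_reach_of_incident [Fintype V] [DecidableRel G.Adj] {v : V} {f g : E.Face}
    (hf : E.Incident v f) (hg : E.Incident v g) : ∃ n, E.Reach n f g := by
  rcases hf with ⟨d, hd, rfl⟩ | ⟨hv, rfl⟩
  · rcases hg with ⟨d', hd', rfl⟩ | ⟨hv, rfl⟩
    · obtain ⟨i, hi⟩ := ((E.toRotationSystem.sameCycle_iff d d').2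
        (hd.trans hd'.symm)).exists_nat_pow_eq
      exact ⟨i, hi ▸ reach_pow_next d i⟩
    · exact absurd (hd ▸ d.adj) (hv _)
  · rcases hg with ⟨d', hd', rfl⟩ | ⟨hv', rfl⟩
    · exact absurd (hd' ▸ d'.adj) (hv _)
    · exact ⟨0, rfl⟩

lemma exists_incident (v : V) : ∃ f, E.Incident v f := by
  by_cases h : ∀ w, ¬ G.Adj v w
  · exact ⟨_, Or.inr ⟨h, rfl⟩⟩
  · push Not at h
    obtain ⟨w, hw⟩ := h
    exact ⟨_, Or.inl ⟨⟨(v, w), hw⟩, rfl, rfl⟩⟩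

lemma exists_reach_of_isPlanar [Fintype V] [DecidableRel G.Adj] (hE : E.IsPlanar) (s t : V) :
    ∃ n f g, E.Incident s f ∧ E.Incident t g ∧ E.Reach n f g := by
  obtain ⟨f₀, hf₀⟩ := exists_incident (E := E) s
  have key : ∀ g, E.Incident t g → ∃ n, E.Reach n f₀ g := by
    induction hE.1 s t with
    | refl => exact fun g hg => exists_reach_of_incident hf₀ hg
    | @tail x y _ hxy ih =>
      have : ∃ f, E.Incident x f ∧ E.Incident y f := by
        rcases hxy with hxy | h
        · exact ⟨_, Or.inl (E.isCorner_fst_leftFace ⟨(x, y), hxy⟩),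
            Or.inl (E.isCorner_snd_leftFace ⟨(x, y), hxy⟩)⟩
        · exact h
      obtain ⟨f, hx, hy⟩ := this
      intro g hg
      obtain ⟨m, hm⟩ := ih f hx
      obtain ⟨n, hn⟩ := exists_reach_of_incident hy hg
      exact ⟨m + n, hm.trans hn⟩
  obtain ⟨g, hg⟩ := exists_incident (E := E) t
  obtain ⟨n, hn⟩ := key g hg
  exact ⟨n, f₀, g, hf₀, hg, hn⟩

lemma reach_of_forall_dart {f : ℕ → E.Face} {K : ℕ}
    (h : ∀ i < K, ∃ d : G.Dart, E.rightFace d = f i ∧ E.leftFace d = f (i + 1)) (i n : ℕ)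
    (hn : i + n ≤ K) : E.Reach n (f i) (f (i + n)) := by
  induction n with
  | zero => exact rfl
  | succ n ih =>
    obtain ⟨d, hr, hl⟩ := h (i + n) (by omega)
    exact ⟨d, hr ▸ ih (by omega), hl⟩

/-- A walk of minimum length among all walks from a face at `s` to a face at `t` is shortest
between any two of its faces. -/
lemma exists_isGeodesic {K : ℕ}
    (h : ∃ f g, E.Incident s f ∧ E.Incident t g ∧ E.Reach K f g)
    (hK : ∀ n f g, E.Incident s f → E.Incident t g → E.Reach n f g → K ≤ n) :
    ∃ f : ℕ → E.Face, IsGeodesic K f ∧ E.Incident s (f 0) ∧ E.Incident t (f K) := by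
  obtain ⟨f, g, hf, hg, hr⟩ := h
  obtain ⟨φ, rfl, rfl, hφ⟩ := hr.exists_seq
  refine ⟨φ, ⟨hφ, fun i j n hj hn => ?_⟩, hf, hg⟩
  by_contra hlt
  have h₁ := reach_of_forall_dart hφ 0 i (by omega)
  have h₂ := reach_of_forall_dart hφ j (K - j) (by omega)
  rw [Nat.zero_add] at h₁
  rw [Nat.add_sub_cancel' hj] at h₂
  have := hK _ _ _ hf hg ((h₁.trans hn).trans h₂)
  omega

end CombinatorialEmbedding

theorem mainTheorem2 {V : Type u} [Fintype V] (G : SimpleGraph V) [DecidableRel G.Adj]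
    (E : CombinatorialEmbedding G) (hE : E.IsPlanar) (hΔ : G.maxDegree ≤ 5)
    (s t : V) (hst : s ≠ t) (hadj : ¬ G.Adj s t) :
    ∃ p : E.STWalk s t, CombinatorialEmbedding.IsShortestSTPath p ∧
      CombinatorialEmbedding.IsConsistent p := by
  classical
  have hex := CombinatorialEmbedding.exists_reach_of_isPlanar hE s t
  have hmin : ∀ n f g, E.Incident s f → E.Incident t g → E.Reach n f g → Nat.find hex ≤ n :=
    fun n f g hf hg h => Nat.find_min' hex ⟨f, g, hf, hg, h⟩
  obtain ⟨f, hf, hs, ht⟩ :=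
    CombinatorialEmbedding.exists_isGeodesic (Nat.find_spec hex) hmin
  obtain ⟨D, hD, hne⟩ := hf.exists_fst_ne_snd hΔ
  obtain ⟨p, hl, hp, hc⟩ := CombinatorialEmbedding.exists_consistent_path hf hD hne hs ht hst
  refine ⟨p, ⟨hp, fun q _ => ?_⟩, hc⟩
  rcases CombinatorialEmbedding.length_lower_bound hmin q with h | h
  · exact absurd h.symm hst
  · exact hl ▸ h
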